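/- Let $d \ge 2$ and let $g_2, \ldots, g_d : [0,\infty) \to [0,\infty)$ be nondecreasing. Let $\{\eta_t\}_{t \ge 0}$ be the nearest-neighbour symmetric simple exclusion process on $\mathbb{Z}^d$, i.e. the $\{0,1\}^{\mathbb{Z}^d}$-valued Markov process with generator $$L f(\eta) = \frac{1}{2d} \sum_{x \in \mathbb{Z}^d} \sum_{|y-x|=1} \eta(x)(1-\eta(y))\bigl(f(\eta^{x,y}) - f(\eta)\bigr)$$ on functions $f$ of finitely many coordinates ($\eta^{x,y}$ is $\eta$ with the values at $x$ and $y$ exchanged), started from the configuration $\eta_0(x) = 1\bigl(x_1 \le 0 \text{ and } |x_i| \le g_i(-x_1) \text{ for } i = 2, \ldots, d\bigr)$. Write $\mathbb{E}_{\{g_i\}}$ for the corresponding expectation. For $t \ge 0$ and $z \in \mathbb{R}$ put $$N_t = \sum_{x \in \mathbb{Z}^d,\ x_1 > z} \eta_t(x), \qquad \mathcal{S}_t(\{g_i\}, z) = \sum_{x \in \mathbb{Z}^d,\ x_1 > z} \bigl(\mathbb{E}_{\{g_i\}}[\eta_t(x)]\bigr)^2, \qquad G(u) = \prod_{i=2}^d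 (2 g_i(u) + 1),$$ and let $\zeta$ be the continuous time simple symmetric random walk on $\mathbb{Z}$ with jumps at rate $1$, started from $0$ under $P_0$, with expectation $E_0$. Then for all $t \ge 0$ and $z \in \mathbb{R}$, $$\mathcal{S}_t(\{g_i\}, z) \le \mathbb{E}_{\{g_i\}}[N_t] \; E_0\bigl[ G(\zeta_{t/d} - z)\, 1(\zeta_{t/d} > z) \bigr],$$ where all quantities take values in $[0,\infty]$ and $0 \cdot \infty = 0$. -/

import Mathlib

open MeasureTheory ProbabilityTheory Filter Topology
open scoped NNReal ENNReal

noncomputable section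

namespace SSEP

/-! ## Symmetric simple exclusion on the integer lattice -/

/-- Sites of the lattice `ℤ^d`. -/
abbrev Site (d : ℕ) : Type := Fin d → ℤ

/-- Particle configurations `{0,1}^(ℤ^d)`; `true` means that the site is occupied.
The topology and the σ-algebra are the product ones. -/
abbrev Config (d : ℕ) : Type := Site d → Bool

/-- The configuration obtained from `c` by exchanging the values at `x` and `y`. -/
def exchange {d : ℕ} (c : Config d) (x y : Site d) : Config d :=
  fun u => c (Equiv.swap x y u)

/-- The contribution `c(x) (1 - c(y)) (f(c^{x,y}) - f(c))` of a jump from `x` to `y`. -/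
def jumpTerm {d : ℕ} (f : Config d → ℝ) (c : Config d) (x y : Site d) : ℝ :=
  if c x = true ∧ c y = false then f (exchange c x y) - f c else 0

/-- The generator of the nearest-neighbour symmetric exclusion process,
`L f (c) = (1 / 2d) ∑_x ∑_{|y - x| = 1} c(x) (1 - c(y)) (f(c^{x,y}) - f(c))`.
It is applied only to functions `f` of finitely many coordinates, for which only finitely many
terms of the sum over `x` are nonzero. -/
def generator {d : ℕ} (f : Config d → ℝ) (c : Config d) : ℝ :=
  (1 / (2 * (d : ℝ))) * ∑' x : Site d, ∑ i : Fin d,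
    (jumpTerm f c x (x + Pi.single i 1) + jumpTerm f c x (x - Pi.single i 1))

/-- `f` depends on the occupation of finitely many sites only. -/
def IsCylinder {d : ℕ} (f : Config d → ℝ) : Prop :=
  ∃ Λ : Finset (Site d), ∀ c c' : Config d, (∀ x ∈ Λ, c x = c' x) → f c = f c'

/-- `η` is a symmetric simple exclusion process on `ℤ^d` started from `c₀`, under the probability
measure `P`: a right-continuous process with left limits, started at `c₀`, which solves the
martingale problem for `generator`. -/
structure IsExclusionProcess {d : ℕ} {Ω : Type*} {mΩ : MeasurableSpace Ω} (P : Measure Ω)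
    (ℱ : Filtration ℝ≥0 mΩ) (η : ℝ≥0 → Ω → Config d) (c₀ : Config d) : Prop where
  isProbabilityMeasure : IsProbabilityMeasure P
  adapted : ∀ t, Measurable[ℱ t] (η t)
  initial : ∀ᵐ ω ∂P, η 0 ω = c₀
  right_continuous : ∀ ω t, ContinuousWithinAt (fun s => η s ω) (Set.Ici t) t
  left_limits : ∀ ω t, ∃ c : Config d, Tendsto (fun s => η s ω) (𝓝[<] t) (𝓝 c)
  martingale : ∀ f : Config d → ℝ, IsCylinder f →
    Martingale (fun (t : ℝ≥0) ω =>
      f (η t ω) - ∫ s in (0 : ℝ)..(t : ℝ), generator f (η s.toNNReal ω)) ℱ P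

/-- The occupation variable at `x`, as an extended nonnegative number. -/
def occ {d : ℕ} (c : Config d) (x : Site d) : ℝ≥0∞ := if c x = true then 1 else 0

/-! ## Particles to the right of a level (the lattice is `ℤ^(n+1)`, coordinate `0` comes first) -/

/-- The sites whose first coordinate is larger than `z`. -/
def rightOf (n : ℕ) (z : ℝ) : Set (Site (n + 1)) := {x | z < (x 0 : ℝ)}

/-- The number of particles of a configuration to the right of level `z`. -/
def numRight {n : ℕ} (z : ℝ) (c : Config (n + 1)) : ℝ≥0∞ := ∑' x : rightOf n z, occ c x

/-- The sum over `x ∈ A` of the squares of the mean occupation `E[X(x)]`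
of a random configuration `X`. -/
def sumSqMean {d : ℕ} {Ω : Type*} [MeasurableSpace Ω] (P : Measure Ω) (X : Ω → Config d)
    (A : Set (Site d)) : ℝ≥0∞ :=
  ∑' x : A, (∫⁻ ω, occ (X ω) x ∂P) ^ 2

/-! ## Initial profiles determined by shape functions -/

/-- The region `{x : x₁ ≤ 0, |x_i| ≤ g_i(-x₁) for i = 2, …, n + 1}`. The functions
`g_2, …, g_{n+1}` are indexed by `Fin n`; for `x₁ ≤ 0` the number `(-x₁).toNat` is `-x₁`. -/
def region {n : ℕ} (g : Fin n → ℝ≥0 → ℝ≥0) : Set (Site (n + 1)) :=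
  {x | x 0 ≤ 0 ∧ ∀ i : Fin n, ((x i.succ).natAbs : ℝ≥0) ≤ g i ((-(x 0)).toNat : ℝ≥0)}

open Classical in
/-- The initial configuration with a particle at each site of the region. -/
def profile {n : ℕ} (g : Fin n → ℝ≥0 → ℝ≥0) : Config (n + 1) :=
  fun x => decide (x ∈ region g)

/-- `G(u) = ∏_i (2 g_i(u) + 1)`. -/
def bigG {n : ℕ} (g : Fin n → ℝ≥0 → ℝ≥0) (u : ℝ≥0) : ℝ≥0 := ∏ i, (2 * g i u + 1)

/-! ## Continuous time simple random walk on the integers -/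

/-- The uniform distribution on `{1, -1}`. -/
def stepLaw : Measure ℤ :=
  (2⁻¹ : ℝ≥0∞) • Measure.dirac 1 + (2⁻¹ : ℝ≥0∞) • Measure.dirac (-1)

/-- The law of the discrete time simple symmetric random walk, started at `0`, after `k` steps. -/
def walkLaw : ℕ → Measure ℤ
  | 0 => Measure.dirac 0
  | k + 1 => Measure.conv (walkLaw k) stepLaw

/-- The law at time `s` of the continuous time simple symmetric random walk on `ℤ` started at `0`
with jumps at rate `1`: the number of steps made by time `s` is Poisson with mean `s`, and is
independent of the steps. -/
def srwLaw (s : ℝ≥0) : Measure ℤ := (poissonMeasure s).bind walkLaw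

/-- `E_0[G(ζ_s - z) 1(ζ_s > z)]` for the continuous time simple random walk `ζ`. -/
def excessMean (G : ℝ≥0 → ℝ≥0) (s : ℝ≥0) (z : ℝ) : ℝ≥0∞ :=
  ∫⁻ k : ℤ, (if z < (k : ℝ) then (G ((k : ℝ) - z).toNNReal : ℝ≥0∞) else 0) ∂(srwLaw s)

end SSEP

end

/-! Each term of the sum is a square, so it suffices to bound one factor, uniformly over the sites
with `x₁ > z`, by the excess mean; the other factors sum to the mean of `N_t` by Tonelli. For the
uniform bound, symmetry of the exclusion rule makes the generator act linearly on single occupation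
variables (`generator_occReal`), so mean occupations solve the lattice heat equation
(`hasDerivAt_meanOcc`). Initially they are at most the indicator of `x₁ ≤ 0`. The solution started
from that indicator depends on `x₁` alone and equals `P_0(ζ_{t/d} ≥ x₁)`, and the comparison
principle `nonneg_of_hasDerivAt_of_averaging` gives `meanOcc_le_srwTail`. Since `G ≥ 1`, this tail
is at most the excess mean when `x₁ > z`. -/

namespace SSEP

/-! ## Exponential generating series of bounded sequences -/

/-- The exponential generating series `∑ s ^ n / n! * a n`. -/
noncomputable def expSeries (a : ℕ → ℝ) (s : ℝ) : ℝ := ∑' n : ℕ, s ^ n / n.factorial * a n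

lemma summable_expSeries {a : ℕ → ℝ} {C : ℝ} (ha : ∀ n, |a n| ≤ C) (s : ℝ) :
    Summable fun n : ℕ => s ^ n / n.factorial * a n := by
  refine Summable.of_norm_bounded ((Real.summable_pow_div_factorial |s|).mul_right C) fun n => ?_
  rw [norm_mul, norm_div, norm_pow, Real.norm_eq_abs, Real.norm_natCast, Real.norm_eq_abs]
  gcongr
  exact ha n

lemma expSeries_zero (a : ℕ → ℝ) : expSeries a 0 = a 0 := by
  rw [expSeries, tsum_eq_single 0 fun n hn => by simp [hn]]
  simp

/-- Termwise differentiation shifts the coefficients; the derivative series is dominated uniformly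
on the ball of radius `|s| + 1`. -/
lemma hasDerivAt_expSeries {a : ℕ → ℝ} {C : ℝ} (ha : ∀ n, |a n| ≤ C) (s : ℝ) :
    HasDerivAt (expSeries a) (expSeries (fun n => a (n + 1)) s) s := by
  have hfac (n : ℕ) (y b : ℝ) :
      ((n + 1 : ℕ) : ℝ) * y ^ n / (n + 1).factorial * b = y ^ n / n.factorial * b := by
    rw [Nat.factorial_succ]
    push_cast
    field_simp
  have hu : Summable fun n : ℕ => (n : ℝ) * (|s| + 1) ^ (n - 1) / n.factorial * C := by
    rw [← summable_nat_add_iff 1]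
    simp only [Nat.add_sub_cancel, hfac]
    exact (Real.summable_pow_div_factorial _).mul_right C
  have hmem : s ∈ Metric.ball (0 : ℝ) (|s| + 1) := by simp
  have key := hasDerivAt_tsum_of_isPreconnected (𝕜 := ℝ)
    (g := fun n y => y ^ n / n.factorial * a n)
    (g' := fun n y => (n : ℝ) * y ^ (n - 1) / n.factorial * a n) hu Metric.isOpen_ball
    (convex_ball (0 : ℝ) (|s| + 1)).isPreconnected
    (fun n y _ => ((hasDerivAt_pow n y).div_const _).mul_const _)
    (fun n y hy => by
      have hy' : |y| ≤ |s| + 1 := by simpa using (mem_ball_zero_iff.mp hy).le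
      rw [norm_mul, norm_div, norm_mul, norm_pow, Real.norm_natCast, Real.norm_natCast,
        Real.norm_eq_abs, Real.norm_eq_abs]
      gcongr
      exact ha n)
    hmem (summable_expSeries ha s) hmem
  refine HasDerivAt.congr_deriv key ?_
  rw [expSeries, Summable.tsum_eq_zero_add (f := fun n : ℕ =>
    (n : ℝ) * s ^ (n - 1) / n.factorial * a n)]
  · simp only [Nat.add_sub_cancel, hfac]
    simp
  · rw [← summable_nat_add_iff 1]
    simp only [Nat.add_sub_cancel, hfac]
    exact summable_expSeries (fun n => ha (n + 1)) s

/-! ## Tails of the simple random walk -/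

instance : IsProbabilityMeasure stepLaw := by
  refine ⟨?_⟩
  simp [stepLaw, ENNReal.inv_two_add_inv_two]

instance (k : ℕ) : IsProbabilityMeasure (walkLaw k) := by
  induction k with
  | zero => unfold walkLaw; infer_instance
  | succ k ih => unfold walkLaw; infer_instance

/-- The probability that the discrete time walk is at least `k` after `m` steps. -/
noncomputable def walkTail (k : ℤ) (m : ℕ) : ℝ := (walkLaw m).real (Set.Ici k)

lemma walkTail_zero (k : ℤ) : walkTail k 0 = if k ≤ 0 then 1 else 0 := by
  simp [walkTail, walkLaw, measureReal_def, Set.indicator_apply]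
  split_ifs <;> simp

lemma walkTail_nonneg (k : ℤ) (m : ℕ) : 0 ≤ walkTail k m := measureReal_nonneg

lemma abs_walkTail_le (k : ℤ) (m : ℕ) : |walkTail k m| ≤ 1 := by
  rw [abs_of_nonneg (walkTail_nonneg k m)]
  exact measureReal_le_one

/-- Condition on the last step. -/
lemma walkTail_succ (k : ℤ) (m : ℕ) :
    walkTail k (m + 1) = (walkTail (k + 1) m + walkTail (k - 1) m) / 2 := by
  have hmap (y : ℤ) : (Measure.conv (walkLaw m) (Measure.dirac y)) (Set.Ici k) =
      walkLaw m (Set.Ici (k - y)) := by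
    rw [Measure.conv_dirac, Measure.map_apply (by fun_prop) measurableSet_Ici]
    congr 1
    ext u
    simp
  have h : walkLaw (m + 1) (Set.Ici k) =
      2⁻¹ * walkLaw m (Set.Ici (k - 1)) + 2⁻¹ * walkLaw m (Set.Ici (k + 1)) := by
    rw [walkLaw, stepLaw, Measure.conv_add, Measure.conv_smul_right, Measure.conv_smul_right,
      Measure.add_apply, Measure.smul_apply, Measure.smul_apply, hmap, hmap]
    simp
  rw [walkTail, measureReal_def, h, ENNReal.toReal_add (by finiteness) (by finiteness)]
  simp [walkTail, measureReal_def]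
  ring

/-- The probability that the continuous time walk is at least `k` at time `s`. -/
noncomputable def srwTail (k : ℤ) (s : ℝ) : ℝ := Real.exp (-s) * expSeries (walkTail k) s

lemma srwTail_zero (k : ℤ) : srwTail k 0 = if k ≤ 0 then 1 else 0 := by
  simp [srwTail, expSeries_zero, walkTail_zero]

/-- Kolmogorov's equation: the factor `exp (-s)` yields the loss term, and the shifted series is the
neighbour average by `walkTail_succ`. -/
lemma hasDerivAt_srwTail (k : ℤ) (s : ℝ) :
    HasDerivAt (srwTail k) ((srwTail (k + 1) s + srwTail (k - 1) s) / 2 - srwTail k s) s := by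
  have h := (hasDerivAt_neg s).exp.mul (hasDerivAt_expSeries (abs_walkTail_le k) s)
  refine HasDerivAt.congr_deriv h ?_
  have hsucc : expSeries (fun m => walkTail k (m + 1)) s =
      (expSeries (walkTail (k + 1)) s + expSeries (walkTail (k - 1)) s) / 2 := by
    rw [expSeries, expSeries, expSeries,
      ← (summable_expSeries (abs_walkTail_le _) s).tsum_add
        (summable_expSeries (abs_walkTail_le _) s), ← tsum_div_const]
    refine tsum_congr fun m => ?_
    rw [walkTail_succ]
    ring
  rw [hsucc, srwTail, srwTail, srwTail]
  ring

/-- Identifies the analytic series with the Poisson mixture of walk laws. -/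
lemma ofReal_srwTail (k : ℤ) (s : ℝ≥0) : ENNReal.ofReal (srwTail k s) = srwLaw s (Set.Ici k) := by
  rw [srwLaw, Measure.bind_apply measurableSet_Ici (measurable_of_countable _).aemeasurable,
    poissonMeasure, lintegral_sum_measure, srwTail, expSeries, ← tsum_mul_left,
    ENNReal.ofReal_tsum_of_nonneg]
  · refine tsum_congr fun m => ?_
    rw [lintegral_smul_measure, lintegral_dirac, ← mul_assoc, ← mul_div_assoc,
      ENNReal.ofReal_mul (by positivity), walkTail, ofReal_measureReal, smul_eq_mul]
  · intro m
    have := walkTail_nonneg k m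
    positivity
  · exact (summable_expSeries (abs_walkTail_le k) s).mul_left _

lemma srwTail_nonneg (k : ℤ) (s : ℝ≥0) : 0 ≤ srwTail k s := by
  refine mul_nonneg (Real.exp_pos _).le (tsum_nonneg fun m => ?_)
  have := walkTail_nonneg k m
  positivity

lemma srwLaw_Ici_le_excessMean {G : ℝ≥0 → ℝ≥0} (hG : ∀ u, 1 ≤ G u) (s : ℝ≥0) {z : ℝ} {k : ℤ}
    (hk : z < k) : srwLaw s (Set.Ici k) ≤ excessMean G s z := by
  rw [← lintegral_indicator_one measurableSet_Ici, excessMean]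
  refine lintegral_mono fun j => ?_
  by_cases hj : k ≤ j
  · have hzj : z < j := hk.trans_le (by exact_mod_cast hj)
    simpa [hj, hzj] using hG _
  · simp [hj]

/-! ## A comparison principle -/

/-- A function of time that solves `v' = K v`, for an operator `K` which preserves lower bounds,
and is bounded below on bounded time intervals, stays nonnegative if it starts nonnegative. -/
lemma nonneg_of_hasDerivAt_of_averaging {ι : Type*} {K : (ι → ℝ) → ι → ℝ}
    (hK : ∀ (c : ℝ) (w : ι → ℝ), (∀ x, c ≤ w x) → ∀ x, c ≤ K w x)
    {v : ℝ → ι → ℝ} {T C : ℝ}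
    (hcont : ∀ x, ContinuousOn (fun t => v t x) (Set.Icc 0 T))
    (hderiv : ∀ x, ∀ t ∈ Set.Ioo 0 T, HasDerivAt (fun t => v t x) (K (v t) x) t)
    (h0 : ∀ x, 0 ≤ v 0 x) (hC : ∀ x, ∀ t ∈ Set.Icc 0 T, -C ≤ v t x)
    (x : ι) {t : ℝ} (ht : t ∈ Set.Icc 0 T) : 0 ≤ v t x := by
  -- Picard-type iteration: a lower bound on `v` passes through `K` to `v'`, and integrating from a
  -- nonnegative start improves the order in `t` by one. The bounds tend to `0` as `m → ∞`.
  have key (m : ℕ) : ∀ x, ∀ t ∈ Set.Icc 0 T, -(C * (t ^ m / m.factorial)) ≤ v t x := by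
    induction m with
    | zero => simpa using hC
    | succ m ih =>
      intro x t ht
      have hd (s : ℝ) : HasDerivAt (fun s : ℝ => C * (s ^ (m + 1) / (m + 1).factorial))
          (C * (s ^ m / m.factorial)) s := by
        refine (((hasDerivAt_pow (m + 1) s).div_const _).const_mul C).congr_deriv ?_
        rw [Nat.factorial_succ, Nat.add_sub_cancel]
        push_cast
        field_simp
      have hmono : MonotoneOn (fun s => v s x + C * (s ^ (m + 1) / (m + 1).factorial))
          (Set.Icc 0 T) := by
        refine monotoneOn_of_hasDerivWithinAt_nonneg
          (f' := fun s => K (v s) x + C * (s ^ m / m.factorial)) (convex_Icc 0 T)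
          ((hcont x).add (by fun_prop)) ?_ ?_
        · intro s hs
          rw [interior_Icc] at hs ⊢
          exact ((hderiv x s hs).add (hd s)).hasDerivWithinAt
        · intro s hs
          rw [interior_Icc] at hs
          linarith [hK _ (v s) (fun y => ih y s (Set.Ioo_subset_Icc_self hs)) x]
      have := hmono (Set.left_mem_Icc.mpr (ht.1.trans ht.2)) ht ht.1
      simp only [ne_eq, Nat.succ_ne_zero, not_false_eq_true, zero_pow, zero_div, mul_zero,
        add_zero] at this
      linarith [h0 x]
  have hlim : Tendsto (fun m : ℕ => -(C * (t ^ m / m.factorial))) atTop (𝓝 0) := by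
    simpa using ((FloorSemiring.tendsto_pow_div_factorial_atTop t).const_mul C).neg
  exact le_of_tendsto' (f := fun m : ℕ => -(C * (t ^ m / m.factorial))) hlim
    fun m => key m x t ht

/-! ## The generator on occupation variables -/

/-- The occupation variable at `x`, as a real number. -/
def occReal {d : ℕ} (x : Site d) (c : Config d) : ℝ := if c x = true then 1 else 0

lemma isCylinder_occReal {d : ℕ} (x : Site d) : IsCylinder (occReal x) :=
  ⟨{x}, fun c c' h => by simp [occReal, h x (Finset.mem_singleton_self x)]⟩

lemma occReal_nonneg {d : ℕ} (x : Site d) (c : Config d) : 0 ≤ occReal x c := by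
  unfold occReal; split_ifs <;> norm_num

lemma occReal_le_one {d : ℕ} (x : Site d) (c : Config d) : occReal x c ≤ 1 := by
  unfold occReal; split_ifs <;> norm_num

lemma continuous_occReal {d : ℕ} (x : Site d) : Continuous (occReal x) :=
  (continuous_of_discreteTopology (f := fun b : Bool => if b = true then (1 : ℝ) else 0)).comp
    (continuous_apply x)

lemma ofReal_occReal {d : ℕ} (x : Site d) (c : Config d) :
    ENNReal.ofReal (occReal x c) = occ c x := by
  unfold occReal occ; split_ifs <;> simp

/-- Only the jump out of `x` and the jump from `x - e` into `x` can change the occupation of `x`. -/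
lemma hasSum_jumpTerm_occReal {d : ℕ} (x : Site d) (c : Config d) {e : Site d} (he : e ≠ 0) :
    HasSum (fun y => jumpTerm (occReal x) c y (y + e))
      (occReal x c * (occReal (x + e) c - 1) + occReal (x - e) c * (1 - occReal x c)) := by
  have hne : x - e ≠ x := by simpa using he
  have h : (fun y => jumpTerm (occReal x) c y (y + e)) = fun y =>
      (if y = x then occReal x c * (occReal (x + e) c - 1) else 0) +
        (if y = x - e then occReal (x - e) c * (1 - occReal x c) else 0) := by
    funext y
    by_cases h1 : y = x
    · subst h1
      rw [if_pos rfl, if_neg hne.symm]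
      rcases hx : c y <;> rcases hx' : c (y + e) <;>
        simp [jumpTerm, occReal, exchange, hx, hx']
    · by_cases h2 : y = x - e
      · subst h2
        rw [if_neg h1, if_pos rfl]
        rcases hx : c x <;> rcases hx' : c (x - e) <;>
          simp [jumpTerm, occReal, exchange, hx, hx']
      · have h3 : x ≠ y + e := fun h => h2 (by rw [h]; simp)
        rw [if_neg h1, if_neg h2]
        simp [jumpTerm, occReal, exchange, Equiv.swap_apply_of_ne_of_ne (Ne.symm h1) h3]
  rw [h]
  exact (hasSum_ite_eq x _).add (hasSum_ite_eq (x - e) _)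

/-- The average of a function over the nearest neighbours of a site. -/
noncomputable def neighborAvg {d : ℕ} (w : Site d → ℝ) (x : Site d) : ℝ :=
  (1 / (2 * (d : ℝ))) * ∑ i : Fin d, (w (x + Pi.single i 1) + w (x - Pi.single i 1))

lemma le_neighborAvg {d : ℕ} (hd : d ≠ 0) (a : ℝ) (w : Site d → ℝ) (hw : ∀ x, a ≤ w x)
    (x : Site d) : a ≤ neighborAvg w x := by
  have h : ∑ _i : Fin d, (a + a) ≤
      ∑ i : Fin d, (w (x + Pi.single i 1) + w (x - Pi.single i 1)) :=
    Finset.sum_le_sum fun i _ => add_le_add (hw _) (hw _)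
  rw [Finset.sum_const, Finset.card_univ, Fintype.card_fin, nsmul_eq_mul] at h
  have hd' : (0 : ℝ) < d := by exact_mod_cast Nat.pos_of_ne_zero hd
  rw [neighborAvg, one_div_mul_eq_div, le_div_iff₀ (by positivity)]
  linarith

lemma neighborAvg_const_mul_sub {d : ℕ} (a : ℝ) (v w : Site d → ℝ) (x : Site d) :
    neighborAvg (fun y => a * (v y - w y)) x = a * (neighborAvg v x - neighborAvg w x) := by
  have h : ∑ i : Fin d, (a * (v (x + Pi.single i 1) - w (x + Pi.single i 1)) +
      a * (v (x - Pi.single i 1) - w (x - Pi.single i 1))) =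
      a * (∑ i : Fin d, (v (x + Pi.single i 1) + v (x - Pi.single i 1)) -
        ∑ i : Fin d, (w (x + Pi.single i 1) + w (x - Pi.single i 1))) := by
    rw [← Finset.sum_sub_distrib, Finset.mul_sum]
    exact Finset.sum_congr rfl fun i _ => by ring
  simp only [neighborAvg, h]
  ring

/-- Only one of the `n + 1` axes moves the first coordinate, whence the time change `t / d`. -/
lemma neighborAvg_comp_zero {n : ℕ} (h : ℤ → ℝ) (x : Site (n + 1)) :
    neighborAvg (fun y => h (y 0)) x =
      h (x 0) + (1 / ((n + 1 : ℕ) : ℝ)) * ((h (x 0 + 1) + h (x 0 - 1)) / 2 - h (x 0)) := by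
  rw [neighborAvg, Fin.sum_univ_succ]
  simp [(Fin.succ_ne_zero _).symm]
  field_simp
  ring

lemma generator_occReal {d : ℕ} (hd : d ≠ 0) (x : Site d) (c : Config d) :
    generator (occReal x) c = neighborAvg (fun y => occReal y c) x - occReal x c := by
  have he (i : Fin d) : (Pi.single i 1 : Site d) ≠ 0 := by simp
  have hs := hasSum_sum (s := Finset.univ) fun (i : Fin d) _ =>
    (hasSum_jumpTerm_occReal x c (he i)).add
      (hasSum_jumpTerm_occReal x c (neg_ne_zero.mpr (he i)))
  simp only [← sub_eq_add_neg, sub_neg_eq_add] at hs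
  have hd' : (d : ℝ) ≠ 0 := by exact_mod_cast hd
  rw [generator, hs.tsum_eq, neighborAvg]
  -- The quadratic terms cancel between the directions `e` and `-e`; this is where symmetry enters.
  have hterm : ∀ i : Fin d,
      (occReal x c * (occReal (x + Pi.single i 1) c - 1) +
          occReal (x - Pi.single i 1) c * (1 - occReal x c) +
        (occReal x c * (occReal (x - Pi.single i 1) c - 1) +
          occReal (x + Pi.single i 1) c * (1 - occReal x c))) =
      (occReal (x + Pi.single i 1) c + occReal (x - Pi.single i 1) c) - 2 * occReal x c :=
    fun i => by ring
  rw [Finset.sum_congr rfl fun i _ => hterm i, Finset.sum_sub_distrib, mul_sub]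
  simp
  field_simp

/-! ## Joint measurability of right-continuous processes -/

/-- The `+ 1` after the floor keeps the grid times at or above `s`, so that right continuity applies
along them. -/
lemma tendsto_floor_add_one_div (s : ℝ≥0) :
    Tendsto (fun m : ℕ => ((⌊((m : ℝ≥0) + 1) * s⌋₊ : ℝ≥0) + 1) / ((m : ℝ≥0) + 1)) atTop
      (𝓝[Set.Ici s] s) := by
  have hle (m : ℕ) : s ≤ ((⌊((m : ℝ≥0) + 1) * s⌋₊ : ℝ≥0) + 1) / ((m : ℝ≥0) + 1) := by
    rw [le_div_iff₀ (by positivity), mul_comm]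
    exact (Nat.lt_floor_add_one _).le
  have hge (m : ℕ) : ((⌊((m : ℝ≥0) + 1) * s⌋₊ : ℝ≥0) + 1) / ((m : ℝ≥0) + 1) ≤
      s + 1 / ((m : ℝ≥0) + 1) := by
    have hm : (m : ℝ≥0) + 1 ≠ 0 := by positivity
    rw [add_div]
    gcongr
    rw [div_le_iff₀ (by positivity), mul_comm s]
    exact Nat.floor_le zero_le
  refine tendsto_nhdsWithin_iff.mpr ⟨?_, .of_forall hle⟩
  refine tendsto_of_tendsto_of_tendsto_of_le_of_le tendsto_const_nhds ?_ hle hge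
  simpa using (tendsto_one_div_add_atTop_nhds_zero_nat (𝕜 := ℝ≥0)).const_add s

lemma measurable_comp_discretized {Ω : Type*} [MeasurableSpace Ω] {X : ℝ≥0 → Ω → ℝ}
    (hX : ∀ t, Measurable (X t)) {τ : ℕ → ℝ≥0} {φ : ℝ≥0 → ℕ} (hφ : Measurable φ) :
    Measurable fun p : ℝ≥0 × Ω => X (τ (φ p.1)) p.2 := by
  have h : Measurable fun q : ℕ × Ω => X (τ q.1) q.2 :=
    measurable_from_prod_countable_right fun k => hX (τ k)
  exact h.comp ((hφ.comp measurable_fst).prodMk measurable_snd)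

lemma measurable_uncurry_of_right_continuous {Ω : Type*} [MeasurableSpace Ω]
    {X : ℝ≥0 → Ω → ℝ} (hX : ∀ t, Measurable (X t))
    (hc : ∀ ω t, ContinuousWithinAt (fun s => X s ω) (Set.Ici t) t) :
    Measurable fun p : ℝ≥0 × Ω => X p.1 p.2 := by
  have hφ (m : ℕ) : Measurable fun s : ℝ≥0 => ⌊((m : ℝ≥0) + 1) * s⌋₊ :=
    Nat.measurable_floor.comp (measurable_const_mul _)
  have hm (m : ℕ) := measurable_comp_discretized hX
    (τ := fun k : ℕ => ((k : ℝ≥0) + 1) / ((m : ℝ≥0) + 1)) (hφ m)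
  refine measurable_of_tendsto_metrizable hm (tendsto_pi_nhds.mpr fun p => ?_)
  have h := (hc p.2 p.1).tendsto
  exact h.comp (tendsto_floor_add_one_div p.1)

/-! ## The mean occupation numbers solve the lattice heat equation -/

/-- The mean occupation of the site `x` at time `max s 0`. -/
noncomputable def meanOcc {d : ℕ} {Ω : Type*} [MeasurableSpace Ω] (P : Measure Ω)
    (η : ℝ≥0 → Ω → Config d) (s : ℝ) (x : Site d) : ℝ :=
  ∫ ω, occReal x (η s.toNNReal ω) ∂P

namespace IsExclusionProcess

variable {d : ℕ} {Ω : Type*} {mΩ : MeasurableSpace Ω} {P : Measure Ω}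
  {ℱ : Filtration ℝ≥0 mΩ} {η : ℝ≥0 → Ω → Config d} {c₀ : Config d}

lemma measurable (hη : IsExclusionProcess P ℱ η c₀) (t : ℝ≥0) : Measurable (η t) :=
  (hη.adapted t).mono (ℱ.le t) le_rfl

lemma measurable_occReal (hη : IsExclusionProcess P ℱ η c₀) (x : Site d) :
    Measurable fun p : ℝ × Ω => occReal x (η p.1.toNNReal p.2) := by
  have h := measurable_uncurry_of_right_continuous (X := fun t ω => occReal x (η t ω))
    (fun t => (measurable_of_countable
      (fun b : Bool => if b = true then (1 : ℝ) else 0)).comp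
        ((measurable_pi_apply x).comp (hη.measurable t)))
    (fun ω t => (continuous_occReal x).continuousAt.comp_continuousWithinAt
      (hη.right_continuous ω t))
  exact h.comp ((measurable_real_toNNReal.comp measurable_fst).prodMk measurable_snd)

lemma integrable_occReal (hη : IsExclusionProcess P ℱ η c₀) (s : ℝ) (x : Site d) :
    Integrable (fun ω => occReal x (η s.toNNReal ω)) P := by
  have := hη.isProbabilityMeasure
  refine .of_bound ((hη.measurable_occReal x).comp measurable_prodMk_left).aestronglyMeasurable 1
    (.of_forall fun ω => ?_)
  rw [Real.norm_of_nonneg (occReal_nonneg _ _)]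
  exact occReal_le_one _ _

lemma meanOcc_nonneg (s : ℝ) (x : Site d) : 0 ≤ meanOcc P η s x :=
  integral_nonneg fun _ => occReal_nonneg _ _

lemma meanOcc_le_one (hη : IsExclusionProcess P ℱ η c₀) (s : ℝ) (x : Site d) :
    meanOcc P η s x ≤ 1 := by
  have := hη.isProbabilityMeasure
  calc meanOcc P η s x ≤ ∫ _, (1 : ℝ) ∂P :=
        integral_mono (hη.integrable_occReal s x) (integrable_const _) fun _ => occReal_le_one _ _
    _ = 1 := by simp

lemma ofReal_meanOcc (hη : IsExclusionProcess P ℱ η c₀) (t : ℝ≥0) (x : Site d) :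
    ENNReal.ofReal (meanOcc P η t x) = ∫⁻ ω, occ (η t ω) x ∂P := by
  rw [meanOcc, ofReal_integral_eq_lintegral_ofReal (hη.integrable_occReal _ x)
    (.of_forall fun _ => occReal_nonneg _ _)]
  simp only [ofReal_occReal, Real.toNNReal_coe]

lemma measurable_meanOcc (hη : IsExclusionProcess P ℱ η c₀) (x : Site d) :
    Measurable fun s => meanOcc P η s x := by
  have := hη.isProbabilityMeasure
  exact (hη.measurable_occReal x).stronglyMeasurable.integral_prod_right.measurable

lemma meanOcc_zero (hη : IsExclusionProcess P ℱ η c₀) (x : Site d) :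
    meanOcc P η 0 x = occReal x c₀ := by
  have := hη.isProbabilityMeasure
  rw [meanOcc, Real.toNNReal_zero, integral_congr_ae
    (hη.initial.mono fun ω h => by simp only [h] : _ =ᵐ[P] fun _ => occReal x c₀)]
  simp

lemma integral_generator_occReal (hη : IsExclusionProcess P ℱ η c₀) (hd : d ≠ 0) (s : ℝ)
    (x : Site d) : ∫ ω, generator (occReal x) (η s.toNNReal ω) ∂P =
      neighborAvg (meanOcc P η s) x - meanOcc P η s x := by
  simp only [generator_occReal hd, neighborAvg, meanOcc]
  have hi (y : Site d) := hη.integrable_occReal s y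
  have hadd (i : Fin d) : Integrable (fun ω => occReal (x + Pi.single i 1) (η s.toNNReal ω) +
      occReal (x - Pi.single i 1) (η s.toNNReal ω)) P := (hi _).add (hi _)
  rw [integral_sub ((integrable_finsetSum _ fun i _ => hadd i).const_mul _) (hi _),
    integral_const_mul, integral_finsetSum _ fun i _ => hadd i]
  simp only [integral_add (hi _) (hi _)]

/-- Take expectations in the martingale problem for the occupation variable and exchange time
integral and expectation by Fubini. -/
lemma meanOcc_eq_add_integral (hη : IsExclusionProcess P ℱ η c₀) (hd : d ≠ 0) {t : ℝ}
    (ht : 0 ≤ t) (x : Site d) :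
    meanOcc P η t x = meanOcc P η 0 x +
      ∫ s in (0 : ℝ)..t, (neighborAvg (meanOcc P η s) x - meanOcc P η s x) := by
  have := hη.isProbabilityMeasure
  lift t to ℝ≥0 using ht
  have hmart := hη.martingale _ (isCylinder_occReal x)
  have hmean := hmart.setIntegral_eq (zero_le (a := t)) MeasurableSet.univ
  simp only [setIntegral_univ, NNReal.coe_zero, intervalIntegral.integral_same, sub_zero] at hmean
  have hgen : Measurable fun p : ℝ × Ω => generator (occReal x) (η p.1.toNNReal p.2) := by
    simp only [generator_occReal hd, neighborAvg]
    exact ((Finset.measurable_sum _ fun i _ => (hη.measurable_occReal _).add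
      (hη.measurable_occReal _)).const_mul _).sub (hη.measurable_occReal _)
  have hbound (c : Config d) : ‖generator (occReal x) c‖ ≤ 1 := by
    have h1 := le_neighborAvg hd 0 (fun y => occReal y c) (fun y => occReal_nonneg y c) x
    -- Averaging the vacancies `1 - occReal` turns the lower bound into an upper bound.
    have h2 := le_neighborAvg hd 0 (fun y => 1 * (1 - occReal y c))
      (fun y => by linarith [occReal_le_one y c]) x
    rw [neighborAvg_const_mul_sub 1 (fun _ => 1)] at h2
    have h3 : neighborAvg (fun _ : Site d => (1 : ℝ)) x = 1 := by
      have hd' : (d : ℝ) ≠ 0 := by exact_mod_cast hd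
      simp [neighborAvg]
      field_simp
      norm_num
    rw [generator_occReal hd, Real.norm_eq_abs, abs_le]
    constructor <;> linarith [occReal_nonneg x c, occReal_le_one x c]
  have hint : Integrable (fun p : ℝ × Ω => generator (occReal x) (η p.1.toNNReal p.2))
      ((volume.restrict (Set.uIoc 0 (t : ℝ))).prod P) := by
    have : IsFiniteMeasure (volume.restrict (Set.uIoc 0 (t : ℝ))) := by
      rw [Set.uIoc]; infer_instance
    exact .of_bound hgen.aestronglyMeasurable 1 (.of_forall fun p => hbound _)
  have hswap := intervalIntegral_integral_swap
    (f := fun s ω => generator (occReal x) (η s.toNNReal ω)) hint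
  have hint' : Integrable (fun ω => ∫ s in (0 : ℝ)..t, generator (occReal x) (η s.toNNReal ω))
      P := by
    have h := hint.integral_prod_right
    rw [Set.uIoc_of_le t.coe_nonneg] at h
    simpa only [intervalIntegral.integral_of_le t.coe_nonneg] using h
  rw [integral_sub (by simpa using hη.integrable_occReal t x) hint', ← hswap] at hmean
  simp only [hη.integral_generator_occReal hd] at hmean
  simp only [meanOcc, Real.toNNReal_coe, Real.toNNReal_zero] at hmean ⊢
  linarith

lemma intervalIntegrable_meanOcc (hη : IsExclusionProcess P ℱ η c₀) (x : Site d) (a b : ℝ) :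
    IntervalIntegrable (fun s => neighborAvg (meanOcc P η s) x - meanOcc P η s x) volume a b := by
  have h (y : Site d) : IntervalIntegrable (fun s => meanOcc P η s y) volume a b := by
    refine (intervalIntegrable_const (c := (1 : ℝ))).mono_fun
      (hη.measurable_meanOcc y).aestronglyMeasurable (.of_forall fun s => ?_)
    simp only [Real.norm_of_nonneg (meanOcc_nonneg _ _)]
    simpa using hη.meanOcc_le_one s y
  have hsum := IntervalIntegrable.sum Finset.univ fun (i : Fin d) _ =>
    (h (x + Pi.single i 1)).add (h (x - Pi.single i 1))
  simpa only [neighborAvg, Finset.sum_apply] using (hsum.const_mul _).sub (h x)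

lemma continuous_meanOcc (hη : IsExclusionProcess P ℱ η c₀) (hd : d ≠ 0) (x : Site d) :
    Continuous fun s => meanOcc P η s x := by
  have h : (fun s => meanOcc P η s x) = fun s => meanOcc P η 0 x +
      -- Negative times are clipped to `0`, hence the upper limit `max s 0`.
      ∫ s in (0 : ℝ)..max s 0, (neighborAvg (meanOcc P η s) x - meanOcc P η s x) := by
    funext s
    rw [← hη.meanOcc_eq_add_integral hd (le_max_right s 0)]
    simp only [meanOcc]
    rw [← Real.coe_toNNReal', Real.toNNReal_coe]
  rw [h]
  exact continuous_const.add ((intervalIntegral.continuous_primitive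
    (hη.intervalIntegrable_meanOcc x) 0).comp (by fun_prop))

/-- Bootstrap: the integrand of the integral equation is now known to be continuous. -/
lemma hasDerivAt_meanOcc (hη : IsExclusionProcess P ℱ η c₀) (hd : d ≠ 0) (x : Site d) {t : ℝ}
    (ht : 0 < t) : HasDerivAt (fun s => meanOcc P η s x)
      (neighborAvg (meanOcc P η t) x - meanOcc P η t x) t := by
  have hc : Continuous fun s => neighborAvg (meanOcc P η s) x - meanOcc P η s x := by
    have h (y : Site d) := hη.continuous_meanOcc hd y
    unfold neighborAvg
    exact (continuous_const.mul (continuous_finsetSum _ fun i _ => (h _).add (h _))).sub (h _)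
  refine ((hc.integral_hasStrictDerivAt 0 t).hasDerivAt.const_add
    (meanOcc P η 0 x)).congr_of_eventuallyEq ?_
  filter_upwards [eventually_gt_nhds ht] with s hs
  exact hη.meanOcc_eq_add_integral hd hs.le x

end IsExclusionProcess

/-- The mean occupation numbers of an exclusion process started to the left of the origin
are at most the tail probabilities of the first coordinate of a simple random walk. -/
lemma IsExclusionProcess.meanOcc_le_srwTail {n : ℕ} {Ω : Type*} {mΩ : MeasurableSpace Ω}
    {P : Measure Ω} {ℱ : Filtration ℝ≥0 mΩ} {η : ℝ≥0 → Ω → Config (n + 1)} {c₀ : Config (n + 1)}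
    (hη : IsExclusionProcess P ℱ η c₀) (hc₀ : ∀ x, c₀ x = true → x 0 ≤ 0) (t : ℝ≥0)
    (x : Site (n + 1)) :
    meanOcc P η t x ≤ srwTail (x 0) (t / ((n + 1 : ℕ) : ℝ)) := by
  have hd := n.succ_ne_zero
  have hsrw (y : Site (n + 1)) (s : ℝ) :
      HasDerivAt (fun s : ℝ => srwTail (y 0) (s / ((n + 1 : ℕ) : ℝ)))
        (neighborAvg (fun y => srwTail (y 0) (s / ((n + 1 : ℕ) : ℝ))) y -
          srwTail (y 0) (s / ((n + 1 : ℕ) : ℝ))) s := by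
    refine ((hasDerivAt_srwTail (y 0) (s / ((n + 1 : ℕ) : ℝ))).comp s
      ((hasDerivAt_id s).div_const ((n + 1 : ℕ) : ℝ))).congr_deriv ?_
    rw [neighborAvg_comp_zero (fun k => srwTail k (s / ((n + 1 : ℕ) : ℝ)))]
    ring
  -- The factor `exp s` absorbs the loss term, leaving `v' = neighborAvg v`. As tails are
  -- nonnegative and mean occupations at most `1`, `v ≥ -exp t` up to time `t`.
  have key := nonneg_of_hasDerivAt_of_averaging (K := neighborAvg)
    (v := fun s y => Real.exp s *
      (srwTail (y 0) (s / ((n + 1 : ℕ) : ℝ)) - meanOcc P η s y)) (T := t) (C := Real.exp t)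
    (fun a w hw y => le_neighborAvg hd a w hw y)
    (fun y => (Real.continuous_exp.mul
      ((continuous_iff_continuousAt.mpr fun s => (hsrw y s).continuousAt).sub
        (hη.continuous_meanOcc hd y))).continuousOn)
    (fun y s hs => ?_) (fun y => ?_) (fun y s hs => ?_) x (t := t) ⟨t.coe_nonneg, le_rfl⟩
  · have := nonneg_of_mul_nonneg_right key (Real.exp_pos _)
    linarith
  · refine ((Real.hasDerivAt_exp s).mul
      ((hsrw y s).sub (hη.hasDerivAt_meanOcc hd y hs.1))).congr_deriv ?_
    rw [neighborAvg_const_mul_sub _ (fun y => srwTail (y 0) (s / ((n + 1 : ℕ) : ℝ)))]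
    simp only [Pi.sub_apply]
    ring
  · rw [zero_div, srwTail_zero, hη.meanOcc_zero, occReal]
    have := hc₀ y
    split_ifs <;> simp_all
  · have h1 := hη.meanOcc_le_one s y
    have h2 : 0 ≤ srwTail (y 0) (s / ((n + 1 : ℕ) : ℝ)) := by
      have h := srwTail_nonneg (y 0) (s.toNNReal / ((n + 1 : ℕ) : ℝ≥0))
      rwa [NNReal.coe_div, Real.coe_toNNReal s hs.1, NNReal.coe_natCast] at h
    have h3 := Real.exp_le_exp.mpr hs.2
    nlinarith [Real.exp_pos s]

/-! ### The initial profile and the final estimate -/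

lemma nonpos_of_profile {n : ℕ} {g : Fin n → ℝ≥0 → ℝ≥0} {x : Site (n + 1)}
    (hx : profile g x = true) : x 0 ≤ 0 := by
  classical
  have h : x ∈ region g := by simpa [profile] using hx
  exact h.1

lemma one_le_bigG {n : ℕ} (g : Fin n → ℝ≥0 → ℝ≥0) (u : ℝ≥0) : 1 ≤ bigG g u :=
  Finset.one_le_prod' fun _ _ => le_add_of_nonneg_left zero_le

end SSEP

theorem proposition4p5 {n : ℕ} (hn : 1 ≤ n)
    -- the dimension is `d = n + 1 ≥ 2`
    (g : Fin n → ℝ≥0 → ℝ≥0) (hg : ∀ i, Monotone (g i))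
    {Ω : Type*} {mΩ : MeasurableSpace Ω} (P : Measure Ω) (ℱ : Filtration ℝ≥0 mΩ)
    (η : ℝ≥0 → Ω → SSEP.Config (n + 1))
    (hη : SSEP.IsExclusionProcess P ℱ η (SSEP.profile g))
    (t : ℝ≥0) (z : ℝ) :
    SSEP.sumSqMean P (η t) (SSEP.rightOf n z) ≤
      (∫⁻ ω, SSEP.numRight z (η t ω) ∂P) *
        SSEP.excessMean (SSEP.bigG g) (t / ((n + 1 : ℕ) : ℝ≥0)) z := by
  have hbound (x : SSEP.rightOf n z) : ∫⁻ ω, SSEP.occ (η t ω) x ∂P ≤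
      SSEP.excessMean (SSEP.bigG g) (t / ((n + 1 : ℕ) : ℝ≥0)) z := by
    refine le_trans ?_ (SSEP.srwLaw_Ici_le_excessMean (SSEP.one_le_bigG g) _ x.2)
    rw [← hη.ofReal_meanOcc, ← SSEP.ofReal_srwTail]
    refine ENNReal.ofReal_le_ofReal ?_
    simpa using hη.meanOcc_le_srwTail
      (fun y hy => SSEP.nonpos_of_profile hy) t x
  have hmeas (x : SSEP.rightOf n z) : Measurable fun ω => SSEP.occ (η t ω) x :=
    (measurable_of_countable (fun b : Bool => if b = true then (1 : ℝ≥0∞) else 0)).comp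
      ((measurable_pi_apply _).comp (hη.measurable t))
  simp only [SSEP.sumSqMean, SSEP.numRight]
  rw [lintegral_tsum fun x => (hmeas x).aemeasurable, ← ENNReal.tsum_mul_right]
  refine ENNReal.tsum_le_tsum fun x => ?_
  -- Keep one factor for the mean of `N_t` and bound the other uniformly.
  rw [sq]
  gcongr
  exact hbound x
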